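/- **Setting.** Let $\rho$ be an unknown state on $n$ qubits, i.e. on $\mathbb C^{2^n}$. A *learning algorithm without quantum memory* that uses $T$ copies is a rooted tree all of whose root-to-leaf paths have length $T$: at each inner node a fresh copy of $\rho$ is measured with a POVM $\{F_s\}_s$ attached to the node (countably many positive semidefinite matrices with $\sum_s F_s=\mathbb 1$), the outcome $s$ occurs with probability $\mathrm{Tr}(F_s\rho)$ and selects the child (so each POVM may depend arbitrarily on all previous outcomes); at the leaf that is reached the algorithm answers "pure" or "maximally mixed" (possibly at random, with probabilities that depend on the leaf). It *distinguishes* pure states from the maximally mixed state with probability at least $2/3$ if it answers "maximally mixed" with probability at least $2/3$ when $\rho=\mathbb 1/2^n$, and answers "pure" with probability at least $2/3$ for every pure state $\rho=|v\rangle\langle v|$, $\|v\|=1$. It *distinguishes them on average* with probability at least $2/3$ if its answer is correct with probability at least $2/3$ when $\rho$ is, with probability $1/2$ each, $\mathbb 1/2^n$ or $|v\rangle\langle v|$ with $v$ uniformly (Haar) distributed on the unit sphere of $\mathbb C^{2^n}$. For $\pi$ in the symmetric group $S_T$, write also $\pi$ for the operator on $(\mathbb C^d)^{\otimes T}$ with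 $\pi(|\psi_1\rangle\otimes\dots\otimes|\psi_T\rangle)=|\psi_{\pi^{-1}(1)}\rangle\otimes\dots\otimes|\psi_{\pi^{-1}(T)}\rangle$. **Theorem.** 1. There is an absolute constant $c>0$ such that, for all $n$ and $T$, every learning algorithm without quantum memory that uses $T$ copies and distinguishes pure $n$-qubit states from the maximally mixed $n$-qubit state with probability at least $2/3$ (either in the worst-case sense or on average) satisfies $T\ge c\,2^{n/2}$. 2. For all $n$ and $T$, with $d=2^n$ and $|\psi\rangle$ uniformly (Haar) distributed on the unit sphere of $\mathbb C^{d}$, $$\mathbb E\big[|\psi\rangle\langle\psi|^{\otimes T}\big]=\frac{1}{d(d+1)\cdots(d+T-1)}\sum_{\pi\in S_T}\pi .$$ 3. For all $d$ and $T$ and all unit vectors $|\psi_1\rangle,\dots,|\psi_T\rangle\in\mathbb C^d$, the number $\sum_{\pi\in S_T}\mathrm{Tr}\big(\pi\bigotimes_{t=1}^T|\psi_t\rangle\langle\psi_t|\big)$ is real and $$\sum_{\pi\in S_T}\mathrm{Tr}\Big(\pi\bigotimes_{t=1}^T|\psi_t\rangle\langle\psi_t|\Big)\ \ge\ 1 .$$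 -/

import Mathlib

open MeasureTheory
open scoped ComplexOrder

noncomputable section

namespace PurityTesting

/-- Vectors of the Hilbert space `ℂ^d`, with the Euclidean norm. -/
abbrev Ket (d : ℕ) : Type := EuclideanSpace ℂ (Fin d)

/-- Complex `d × d` matrices, i.e. operators on `ℂ^d` in the standard basis. -/
abbrev Op (d : ℕ) : Type := Matrix (Fin d) (Fin d) ℂ

/-- The operator `|v⟩⟨v|`. -/
def ketbra {d : ℕ} (v : Ket d) : Op d :=
  Matrix.of fun i j => v i * star (v j)

/-- `ρ` is a pure state: `ρ = |v⟩⟨v|` for a unit vector `v`. -/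
def IsPureState {d : ℕ} (ρ : Op d) : Prop :=
  ∃ v : Ket d, ‖v‖ = 1 ∧ ρ = ketbra v

/-- The maximally mixed state `I / d`. -/
def maximallyMixed (d : ℕ) : Op d := (d : ℂ)⁻¹ • (1 : Op d)

/-- A positive operator-valued measure on `ℂ^d` with outcomes in `S`: positive semidefinite
matrices `F_s` with `∑ s, F_s = I`. For a finite `S` the sum is the ordinary finite sum. -/
structure POVM (d : ℕ) (S : Type) where
  effect : S → Op d
  posSemidef : ∀ s, (effect s).PosSemidef
  hasSum_effect : HasSum effect 1

/-- The probability `Tr(F_s ρ)` of the outcome `s` when `ρ` is measured. -/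
def POVM.prob {d : ℕ} {S : Type} (F : POVM d S) (ρ : Op d) (s : S) : ℝ :=
  (F.effect s * ρ).trace.re

/-- A learning algorithm without quantum memory for the purity testing task, as a rooted tree all
of whose root-to-leaf paths have length `T`. At an inner node a fresh copy of the unknown state is
measured with the POVM of that node, and the outcome selects the child; the POVM thus depends on
all previous outcomes in an arbitrary way. At a leaf the algorithm answers `true`
("the state is pure") with probability `q` and `false` ("the state is maximally mixed") with
probability `1 - q`; deterministic answers are `q = 1` and `q = 0`. -/
inductive Learner (d : ℕ) : ℕ → Type 1
  | leaf (q : unitInterval) : Learner d 0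
  | measure {T : ℕ} (S : Type) (hS : Countable S) (F : POVM d S) (next : S → Learner d T) :
      Learner d (T + 1)

/-- The probability that the algorithm answers `b` when every copy is in the state `ρ`, i.e. the
sum over all leaves `ℓ` of the probability of reaching `ℓ` (the product of the outcome
probabilities along the path to `ℓ`) times the probability of the answer `b` at `ℓ`. -/
def Learner.answerProb {d : ℕ} : {T : ℕ} → Learner d T → Op d → Bool → ℝ
  | _, .leaf q, _, b => if b then (q : ℝ) else 1 - (q : ℝ)
  | _, .measure S _ F next, ρ, b => ∑' s : S, F.prob ρ s * (next s).answerProb ρ b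

/-- The algorithm distinguishes pure states from the maximally mixed state with probability at
least `2/3`: its answer is correct with that probability on every one of these states. -/
def Learner.Distinguishes {d T : ℕ} (A : Learner d T) : Prop :=
  2 / 3 ≤ A.answerProb (maximallyMixed d) false ∧
    ∀ ρ : Op d, IsPureState ρ → 2 / 3 ≤ A.answerProb ρ true

/-- The uniform (Haar) probability measure on the unit vectors of `ℂ^d`: the normalized surface
measure of the unit sphere. -/
def haarKet (d : ℕ) : Measure (Metric.sphere (0 : Ket d) 1) :=
  ((volume : Measure (Ket d)).toSphere Set.univ)⁻¹ • (volume : Measure (Ket d)).toSphere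

/-- The average-case task: the unknown state is the maximally mixed state or a Haar-random pure
state, with probability `1/2` each, and the algorithm's answer is correct with overall probability
at least `2/3`. -/
def Learner.DistinguishesOnAverage {d T : ℕ} (A : Learner d T) : Prop :=
  2 / 3 ≤ (1 / 2) * A.answerProb (maximallyMixed d) false +
    (1 / 2) * ∫ v, A.answerProb (ketbra (v : Ket d)) true ∂(haarKet d)

/-- The tensor product `A₁ ⊗ ⋯ ⊗ A_T`, as a matrix over the product basis of `(ℂ^d)^{⊗T}`. -/
def tensorOp {d T : ℕ} (A : Fin T → Op d) : Matrix (Fin T → Fin d) (Fin T → Fin d) ℂ :=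
  Matrix.of fun i j => ∏ t, A t (i t) (j t)

/-- The permutation operator on `(ℂ^d)^{⊗T}`, which sends the basis vector
`e_{j 1} ⊗ ⋯ ⊗ e_{j T}` to `e_{j (π⁻¹ 1)} ⊗ ⋯ ⊗ e_{j (π⁻¹ T)}`. -/
def permOp (d : ℕ) {T : ℕ} (π : Equiv.Perm (Fin T)) :
    Matrix (Fin T → Fin d) (Fin T → Fin d) ℂ :=
  Matrix.of fun i j => if i = j ∘ π.symm then 1 else 0

end PurityTesting

end

/-!
The lower bound compares, outcome by outcome, a Haar-random pure state with the maximally mixed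
state. After `T` rounds the learner has seen effects `F₁, …, F_T`; the maximally mixed state
produces them with probability `∏ Tr F_t / d ^ T`, and a Haar-random pure state with probability
`E ∏ ⟨v|F_t|v⟩`. By the moment formula `integral_tensorOp_ketbra` the latter is
`(d (d + 1) ⋯ (d + T - 1))⁻¹ ∑ π, Tr (π ⨂ F_t)`. Decomposing each `F_t` into rank-one operators and
using `prod_norm_sq_le_sum_trace`, it is at least `∏ Tr F_t / (d (d + 1) ⋯ (d + T - 1))`
(`prod_trace_le_integral`). So every leaf is reached in the pure case with at least
`d ^ T / (d ⋯ (d + T - 1)) ≥ 1 - T ^ 2 / d` times its probability in the mixed case. Induction over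
the tree (`Learner.answerProb_maximallyMixed_le_integral`) turns this into a bound on the answer
probabilities, and success probability `2 / 3` forces `d ≤ 3 T ^ 2`.

The inequality `prod_norm_sq_le_sum_trace` bounds the permanent of a Gram matrix. That permanent is
`1 / T!` times the squared norm of the symmetrised product vector. Multiplying a symmetric tensor by
one more vector `ψ`, as the bosonic creation operator `a†` does, increases the squared norm by the
factor `‖ψ‖ ^ 2` at least, since `a a† = a† a + ‖ψ‖ ^ 2`; in coordinates this is
`sum_symProd_mul_star_succ_ge`.

For the moment formula, the Gaussian integral over `ℂ^d` of a monomial in the coordinates and their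
conjugates is evaluated twice: in polar coordinates it is the integral over the sphere times a value
of the Gamma function, and in product coordinates it is a product of one-dimensional integrals,
which vanishes unless each coordinate occurs as often as its conjugate and is a product of
factorials otherwise. That product counts the permutations taking one index word to the other
(`sum_permOp_apply`).
-/

namespace PurityTesting

/-! ### Permanents of Gram matrices -/

/-- The unnormalised symmetrisation of the product vector `ψ₁ ⊗ ⋯ ⊗ ψ_T`, in coordinates. -/
noncomputable def symProd {d T : ℕ} (ψ : Fin T → Ket d) (i : Fin T → Fin d) : ℂ :=
  ∑ σ : Equiv.Perm (Fin T), ∏ t, ψ t (i (σ t))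

theorem symProd_comp_perm {d T : ℕ} (ψ : Fin T → Ket d) (i : Fin T → Fin d)
    (τ : Equiv.Perm (Fin T)) : symProd ψ (i ∘ τ) = symProd ψ i :=
  Equiv.sum_comp (Equiv.mulLeft τ) fun σ : Equiv.Perm (Fin T) => ∏ t, ψ t (i (σ t))

theorem symProd_succ {d T : ℕ} (ψ : Fin (T + 1) → Ket d) (i : Fin (T + 1) → Fin d) :
    symProd ψ i =
      ∑ p, ψ 0 (i p) * symProd (Fin.tail ψ) (Fin.tail (i ∘ Equiv.swap 0 p)) := by
  rw [symProd, ← Equiv.Perm.decomposeFin.symm.sum_comp, Fintype.sum_prod_type]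
  refine Finset.sum_congr rfl fun p _ => ?_
  rw [symProd, Finset.mul_sum]
  refine Finset.sum_congr rfl fun e _ => ?_
  rw [Fin.prod_univ_succ]
  simp [Fin.tail]

theorem tail_cons_comp_swap {d T : ℕ} (x : Fin d) (r : Fin T → Fin d) (p : Fin T) :
    Fin.tail ((Fin.cons x r : Fin (T + 1) → Fin d) ∘ Equiv.swap 0 p.succ) =
      Function.update r p x := by
  ext t
  rcases eq_or_ne t p with rfl | h
  · simp [Fin.tail]
  · have : Equiv.swap 0 p.succ t.succ = t.succ :=
      Equiv.swap_apply_of_ne_of_ne (Fin.succ_ne_zero t) (by simpa using h)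
    simp [Fin.tail, this, h]

/-- The summands of `symProd_succ` for `i = x :: r`: position `0` is filled by `ψ 0`, or else
`ψ 0` takes the place of some `r p` and `x` moves there. -/
theorem symProd_cons {d T : ℕ} (ψ : Fin (T + 1) → Ket d) (x : Fin d) (r : Fin T → Fin d) :
    symProd ψ (Fin.cons x r : Fin (T + 1) → Fin d) = ψ 0 x * symProd (Fin.tail ψ) r +
      ∑ p, ψ 0 (r p) * symProd (Fin.tail ψ) (Function.update r p x) := by
  rw [symProd_succ, Fin.sum_univ_succ]
  simp only [tail_cons_comp_swap, Fin.cons_succ]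
  simp

/-- The sum is the squared norm of the contraction of `Φ` with `a` in the `p`-th tensor factor. -/
theorem sum_exchange_nonneg {d T : ℕ} (a : Fin d → ℂ) (Φ : (Fin T → Fin d) → ℂ) (p : Fin T) :
    0 ≤ ∑ r, ∑ x, a x * Φ r * star (a (r p) * Φ (Function.update r p x)) := by
  -- Split a word `r` into its letter `y` at `p` and the other letters `s`.
  have key : ∀ (y x : Fin d) (s : {j // j ≠ p} → Fin d),
      Function.update ((Equiv.funSplitAt p (Fin d)).symm (y, s)) p x =
        (Equiv.funSplitAt p (Fin d)).symm (x, s) := by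
    intro y x s
    ext t
    rcases eq_or_ne t p with rfl | h
    · simp [Equiv.funSplitAt, Equiv.piSplitAt]
    · simp [Equiv.funSplitAt, Equiv.piSplitAt, h]
  have hp : ∀ (y : Fin d) (s : {j // j ≠ p} → Fin d),
      (Equiv.funSplitAt p (Fin d)).symm (y, s) p = y := by
    intro y s
    simp [Equiv.funSplitAt, Equiv.piSplitAt]
  rw [← (Equiv.funSplitAt p (Fin d)).symm.sum_comp, Fintype.sum_prod_type, Finset.sum_comm]
  refine Finset.sum_nonneg fun s _ => ?_
  set G : Fin d → ℂ := fun y => Φ ((Equiv.funSplitAt p (Fin d)).symm (y, s)) with hG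
  have : ∑ y, ∑ x, a x * G y * star (a y * G x) =
      (∑ x, a x * star (G x)) * star (∑ x, a x * star (G x)) := by
    rw [star_sum, Finset.sum_mul_sum, Finset.sum_comm]
    refine Finset.sum_congr rfl fun y _ => Finset.sum_congr rfl fun x _ => ?_
    simp only [star_mul', star_star]
    ring
  simp only [key, hp]
  rw [this]
  exact mul_star_self_nonneg _

/-- Symmetrising with one more factor increases the squared norm by at least the factor
`(T + 1) ‖ψ₀‖²`: the bosonic commutation relation `a a† = a† a + ‖ψ₀‖²`, in which `a† a` is
positive. -/
theorem sum_symProd_mul_star_succ_ge {d T : ℕ} (ψ : Fin (T + 1) → Ket d) :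
    ((T + 1 : ℕ) : ℂ) * ((∑ x, ψ 0 x * star (ψ 0 x)) *
        ∑ r, symProd (Fin.tail ψ) r * star (symProd (Fin.tail ψ) r)) ≤
      ∑ i, symProd ψ i * star (symProd ψ i) := by
  have h1 : ∑ i, symProd ψ i * star (symProd ψ i) =
      ((T + 1 : ℕ) : ℂ) *
        ∑ i, ψ 0 (i 0) * symProd (Fin.tail ψ) (Fin.tail i) * star (symProd ψ i) := by
    calc ∑ i, symProd ψ i * star (symProd ψ i)
        = ∑ i, ∑ p, ψ 0 (i p) * symProd (Fin.tail ψ) (Fin.tail (i ∘ Equiv.swap 0 p)) *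
            star (symProd ψ i) := by
          refine Finset.sum_congr rfl fun i _ => ?_
          rw [← Finset.sum_mul, ← symProd_succ]
      _ = ∑ p : Fin (T + 1), ∑ i, ψ 0 (i 0) * symProd (Fin.tail ψ) (Fin.tail i) *
            star (symProd ψ i) := by
          rw [Finset.sum_comm]
          refine Finset.sum_congr rfl fun p _ => ?_
          -- `symProd ψ` is symmetric, so each `p` contributes as much as `p = 0`.
          rw [← ((Equiv.swap 0 p).arrowCongr (Equiv.refl (Fin d))).sum_comp]
          refine Finset.sum_congr rfl fun i _ => ?_
          have e : ((Equiv.swap 0 p).arrowCongr (Equiv.refl (Fin d))) i =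
              i ∘ Equiv.swap 0 p := by
            ext t
            simp [Equiv.arrowCongr]
          have e2 : (i ∘ Equiv.swap 0 p) ∘ Equiv.swap 0 p = i := by
            ext t
            simp
          rw [e, symProd_comp_perm, e2]
          simp
      _ = _ := by simp
  have h2 : ∑ i, ψ 0 (i 0) * symProd (Fin.tail ψ) (Fin.tail i) * star (symProd ψ i) =
      (∑ x, ψ 0 x * star (ψ 0 x)) *
        (∑ r, symProd (Fin.tail ψ) r * star (symProd (Fin.tail ψ) r)) +
      ∑ p, ∑ r, ∑ x, ψ 0 x * symProd (Fin.tail ψ) r *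
        star (ψ 0 (r p) * symProd (Fin.tail ψ) (Function.update r p x)) := by
    rw [← (Fin.consEquiv (fun _ : Fin (T + 1) => Fin d)).sum_comp, Fintype.sum_prod_type,
      Finset.sum_mul_sum]
    have : ∀ (x : Fin d) (r : Fin T → Fin d),
        (Fin.consEquiv (fun _ : Fin (T + 1) => Fin d)) (x, r) =
          (Fin.cons x r : Fin (T + 1) → Fin d) := fun _ _ => rfl
    simp only [this, symProd_cons, Fin.cons_zero, Fin.tail_cons, star_add, star_sum, mul_add,
      Finset.mul_sum, Finset.sum_add_distrib]
    congr 1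
    · refine Finset.sum_congr rfl fun y _ => Finset.sum_congr rfl fun x _ => ?_
      rw [star_mul']
      ring
    · rw [Finset.sum_comm]
      simp_rw [Finset.sum_comm (s := (Finset.univ : Finset (Fin d)))
        (t := (Finset.univ : Finset (Fin T)))]
      rw [Finset.sum_comm]
  rw [h1, h2, mul_add]
  refine le_add_of_nonneg_right (mul_nonneg (Nat.cast_nonneg _) ?_)
  exact Finset.sum_nonneg fun p _ => sum_exchange_nonneg (fun x => ψ 0 x) _ p

theorem sum_mul_star_eq_norm_sq {d : ℕ} (v : Ket d) :
    ∑ x, v x * star (v x) = ((‖v‖ ^ 2 : ℝ) : ℂ) := by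
  rw [EuclideanSpace.norm_sq_eq]
  push_cast
  refine Finset.sum_congr rfl fun x _ => ?_
  exact Complex.mul_conj' (v x)

theorem factorial_mul_prod_norm_sq_le {d T : ℕ} (ψ : Fin T → Ket d) :
    (T.factorial : ℂ) * ((∏ t, ‖ψ t‖ ^ 2 : ℝ) : ℂ) ≤
      ∑ i, symProd ψ i * star (symProd ψ i) := by
  induction T with
  | zero => simp [symProd]
  | succ T ih =>
    refine le_trans ?_ (sum_symProd_mul_star_succ_ge ψ)
    rw [Nat.factorial_succ, Fin.prod_univ_succ, sum_mul_star_eq_norm_sq]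
    have h0 : (0 : ℂ) ≤ ((‖ψ 0‖ ^ 2 : ℝ) : ℂ) := by
      rw [Complex.zero_le_real]
      positivity
    have := mul_le_mul_of_nonneg_left (ih (Fin.tail ψ))
      (mul_nonneg (Nat.cast_nonneg (α := ℂ) (T + 1)) h0)
    refine le_trans (le_of_eq ?_) (this.trans (le_of_eq ?_))
    · push_cast [Fin.tail]
      ring
    · ring

theorem trace_permOp_mul_tensorOp {d T : ℕ} (ψ : Fin T → Ket d) (π : Equiv.Perm (Fin T)) :
    (permOp d π * tensorOp (fun t => ketbra (ψ t))).trace =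
      ∑ j : Fin T → Fin d, ∏ t, ψ t (j t) * star (ψ t (j (π.symm t))) := by
  simp only [Matrix.trace, Matrix.diag_apply, Matrix.mul_apply, permOp, tensorOp, ketbra,
    Matrix.of_apply, ite_mul, one_mul, zero_mul]
  rw [Finset.sum_comm]
  simp

/-- The squared norm of a symmetrised product vector is a sum over pairs of permutations whose
terms depend only on the quotient of the two, whence the factor `T!`. -/
theorem sum_symProd_mul_star {d T : ℕ} (ψ : Fin T → Ket d) :
    ∑ i, symProd ψ i * star (symProd ψ i) = (T.factorial : ℂ) *
      ∑ π : Equiv.Perm (Fin T),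
        (permOp d π * tensorOp (fun t => ketbra (ψ t))).trace := by
  calc ∑ i, symProd ψ i * star (symProd ψ i)
      = ∑ σ : Equiv.Perm (Fin T), ∑ i : Fin T → Fin d,
          (∏ t, ψ t (i (σ t))) * star (symProd ψ i) := by
        rw [Finset.sum_comm]
        refine Finset.sum_congr rfl fun i _ => ?_
        rw [← Finset.sum_mul, ← symProd]
    _ = ∑ _σ : Equiv.Perm (Fin T), ∑ i : Fin T → Fin d,
          (∏ t, ψ t (i t)) * star (symProd ψ i) := by
        refine Finset.sum_congr rfl fun σ _ => ?_
        rw [← (σ.arrowCongr (Equiv.refl (Fin d))).sum_comp]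
        refine Finset.sum_congr rfl fun i _ => ?_
        have e : (σ.arrowCongr (Equiv.refl (Fin d))) i = i ∘ σ.symm := rfl
        rw [e, symProd_comp_perm]
        simp
    _ = _ := by
        rw [Finset.sum_const, Finset.card_univ, Fintype.card_perm, Fintype.card_fin,
          nsmul_eq_mul]
        congr 1
        simp only [trace_permOp_mul_tensorOp, symProd, star_sum, Finset.mul_sum]
        rw [Finset.sum_comm, ← Equiv.sum_comp (Equiv.inv (Equiv.Perm (Fin T)))]
        refine Finset.sum_congr rfl fun π _ => Finset.sum_congr rfl fun j _ => ?_
        rw [star_prod, Finset.prod_mul_distrib]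
        rfl

/-- The right-hand side is the permanent of the Gram matrix of the vectors `ψ t`, so this bounds
that permanent below by the product of the diagonal entries (Marcus's inequality). -/
theorem prod_norm_sq_le_sum_trace {d T : ℕ} (ψ : Fin T → Ket d) :
    ((∏ t, ‖ψ t‖ ^ 2 : ℝ) : ℂ) ≤ ∑ π : Equiv.Perm (Fin T),
      (permOp d π * tensorOp (fun t => ketbra (ψ t))).trace := by
  have h := factorial_mul_prod_norm_sq_le ψ
  rw [sum_symProd_mul_star] at h
  have hT : (0 : ℂ) < (T.factorial : ℂ) := by exact_mod_cast T.factorial_pos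
  exact le_of_mul_le_mul_left h hT

/-! ### Gaussian integrals over `ℂ^d` -/

open Set in
/-- Integration in polar coordinates of a positively homogeneous function times a radial one. -/
theorem integral_homogeneous_mul_radial {E : Type*} [NormedAddCommGroup E] [NormedSpace ℝ E]
    [MeasurableSpace E] [BorelSpace E] [FiniteDimensional ℝ E] [Nontrivial E]
    (μ : Measure E) [μ.IsAddHaarMeasure] {f : E → ℂ} {k : ℕ}
    (hf : ∀ r : ℝ, 0 < r → ∀ x, f (r • x) = (r : ℂ) ^ k * f x) (g : ℝ → ℝ) :
    ∫ x, f x * (g ‖x‖ : ℂ) ∂μ = (∫ v : Metric.sphere (0 : E) 1, f v ∂μ.toSphere) *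
      ((∫ r in Ioi (0 : ℝ), r ^ (Module.finrank ℝ E - 1) * (r ^ k * g r) : ℝ) : ℂ) := by
  calc ∫ x, f x * (g ‖x‖ : ℂ) ∂μ
      = ∫ x : ({(0)}ᶜ : Set E), f x * (g ‖x.1‖ : ℂ) ∂(μ.comap (↑)) := by
        rw [integral_subtype_comap (measurableSet_singleton _).compl
          fun x ↦ f x * (g ‖x‖ : ℂ), restrict_compl_singleton]
    _ = ∫ x : Metric.sphere (0 : E) 1 × Ioi (0 : ℝ), f x.1 * ((x.2.1 ^ k * g x.2.1 : ℝ) : ℂ)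
          ∂μ.toSphere.prod (.volumeIoiPow (Module.finrank ℝ E - 1)) := by
        rw [← μ.measurePreserving_homeomorphUnitSphereProd.integral_comp
          (Homeomorph.measurableEmbedding _)]
        refine integral_congr_ae (Filter.Eventually.of_forall fun x => ?_)
        have hx : 0 < ‖x.1‖ := norm_pos_iff.2 x.2
        have := hf ‖x.1‖ hx (‖x.1‖⁻¹ • x.1)
        rw [smul_inv_smul₀ hx.ne'] at this
        simp only [homeomorphUnitSphereProd_apply_fst_coe,
          homeomorphUnitSphereProd_apply_snd_coe]
        rw [this]
        push_cast
        ring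
    _ = (∫ v : Metric.sphere (0 : E) 1, f v ∂μ.toSphere) *
          ∫ r : Ioi (0 : ℝ), ((r.1 ^ k * g r.1 : ℝ) : ℂ)
            ∂.volumeIoiPow (Module.finrank ℝ E - 1) :=
        integral_prod_mul (fun v : Metric.sphere (0 : E) 1 => f v)
          (fun r : Ioi (0 : ℝ) => ((r.1 ^ k * g r.1 : ℝ) : ℂ))
    _ = _ := by
        congr 1
        rw [integral_complex_ofReal]
        congr 1
        simp only [Measure.volumeIoiPow, ENNReal.ofReal]
        rw [integral_withDensity_eq_integral_smul,
          integral_subtype_comap measurableSet_Ioi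
            fun a ↦ Real.toNNReal (a ^ (Module.finrank ℝ E - 1)) • (a ^ k * g a),
          setIntegral_congr_fun measurableSet_Ioi fun x hx ↦ ?_]
        · rw [NNReal.smul_def, Real.coe_toNNReal _ (pow_nonneg hx.out.le _), smul_eq_mul]
        · exact (measurable_subtype_coe.pow_const _).real_toNNReal

theorem integral_Ioi_pow_mul_pow_mul_exp_neg_sq {d : ℕ} (hd : 0 < d) (T : ℕ) :
    ∫ r in Set.Ioi (0 : ℝ), r ^ (2 * d - 1) * (r ^ (2 * T) * Real.exp (-r ^ 2)) =
      (d + T - 1).factorial / 2 := by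
  have h := integral_rpow_mul_exp_neg_rpow (p := 2) (q := ((2 * d - 1 + 2 * T : ℕ) : ℝ))
    (by norm_num) (lt_of_lt_of_le (by norm_num) (Nat.cast_nonneg _))
  have e : (((2 * d - 1 + 2 * T : ℕ) : ℝ) + 1) / 2 = ((d + T - 1 : ℕ) : ℝ) + 1 := by
    have : 2 * d - 1 + 2 * T + 1 = 2 * (d + T - 1 + 1) := by omega
    have h' : (((2 * d - 1 + 2 * T : ℕ) : ℝ) + 1) = 2 * (((d + T - 1 : ℕ) : ℝ) + 1) := by
      exact_mod_cast this
    rw [h']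
    ring
  rw [e, Real.Gamma_nat_eq_factorial] at h
  rw [show ((d + T - 1).factorial / 2 : ℝ) = 1 / 2 * (d + T - 1).factorial by ring, ← h]
  refine setIntegral_congr_fun measurableSet_Ioi fun x hx => ?_
  simp only [Real.rpow_natCast, Real.rpow_two]
  ring

theorem integral_pow_mul_star_pow_mul_gaussian (m n : ℕ) :
    ∫ z : ℂ, z ^ m * star z ^ n * (Real.exp (-‖z‖ ^ 2) : ℂ) =
      if m = n then (Real.pi * m.factorial : ℂ) else 0 := by
  split_ifs with h
  · subst h
    have h := Complex.integral_rpow_mul_exp_neg_rpow (p := 2) (q := ((2 * m : ℕ) : ℝ))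
      (by norm_num) (lt_of_lt_of_le (by norm_num) (Nat.cast_nonneg _))
    have e : (((2 * m : ℕ) : ℝ) + 2) / 2 = (m : ℝ) + 1 := by push_cast; ring
    rw [e, Real.Gamma_nat_eq_factorial] at h
    have h' : (Real.pi * m.factorial : ℂ) = ((2 * Real.pi / 2 * m.factorial : ℝ) : ℂ) := by
      push_cast; ring
    rw [h', ← h, ← integral_complex_ofReal]
    congr 1
    ext z
    rw [← mul_pow, Real.rpow_natCast, Real.rpow_two, pow_mul]
    push_cast
    congr 2
    exact Complex.mul_conj' z
  · -- The rotation by `ω` multiplies the integrand by `-1`.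
    have hmn : (m : ℝ) - n ≠ 0 := sub_ne_zero.2 (by exact_mod_cast h)
    set ω : Circle := Circle.exp (Real.pi / (m - n)) with hω
    have hωmn : (ω : ℂ) ^ m * star (ω : ℂ) ^ n = -1 := by
      have : star (ω : ℂ) = Complex.exp (-(((Real.pi / (m - n) : ℝ) : ℂ) * Complex.I)) := by
        rw [hω, Circle.coe_exp, Complex.star_def, ← Complex.exp_conj]
        simp
      rw [this, hω, Circle.coe_exp, ← Complex.exp_nat_mul, ← Complex.exp_nat_mul,
        ← Complex.exp_add, ← Complex.exp_pi_mul_I]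
      congr 1
      have : ((m : ℂ) - n) ≠ 0 := by exact_mod_cast hmn
      push_cast
      field_simp
      ring
    have hI := (rotation ω).measurePreserving.integral_comp
      (rotation ω).toHomeomorph.measurableEmbedding
      (fun z : ℂ => z ^ m * star z ^ n * (Real.exp (-‖z‖ ^ 2) : ℂ))
    have hneg : ∀ z : ℂ, rotation ω z ^ m * star (rotation ω z) ^ n *
        (Real.exp (-‖rotation ω z‖ ^ 2) : ℂ) =
        -(z ^ m * star z ^ n * (Real.exp (-‖z‖ ^ 2) : ℂ)) := by
      intro z
      rw [LinearIsometryEquiv.norm_map, rotation_apply, star_mul', mul_pow, mul_pow]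
      linear_combination (z ^ m * star z ^ n * (Real.exp (-‖z‖ ^ 2) : ℂ)) * hωmn
    simp only [hneg, integral_neg] at hI
    exact self_eq_neg.1 hI.symm

theorem integral_pi_monomial_mul_gaussian {d : ℕ} (m n : Fin d → ℕ) :
    ∫ z : Fin d → ℂ, (∏ a, z a ^ m a * star (z a) ^ n a) *
        (Real.exp (-∑ a, ‖z a‖ ^ 2) : ℂ) =
      if m = n then (Real.pi : ℂ) ^ d * ∏ a, ((m a).factorial : ℂ) else 0 := by
  have h := integral_fintype_prod_volume_eq_prod (𝕜 := ℂ)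
    (fun (a : Fin d) (z : ℂ) => z ^ m a * star z ^ n a * (Real.exp (-‖z‖ ^ 2) : ℂ))
  simp only [integral_pow_mul_star_pow_mul_gaussian] at h
  have e : ∀ z : Fin d → ℂ, (∏ a, z a ^ m a * star (z a) ^ n a) *
        (Real.exp (-∑ a, ‖z a‖ ^ 2) : ℂ) =
      ∏ a, z a ^ m a * star (z a) ^ n a * (Real.exp (-‖z a‖ ^ 2) : ℂ) := by
    intro z
    rw [Finset.prod_mul_distrib (g := fun a => (Real.exp (-‖z a‖ ^ 2) : ℂ)),
      ← Finset.sum_neg_distrib, Real.exp_sum]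
    push_cast
    rfl
  simp only [e]
  rw [h]
  split_ifs with hmn
  · subst hmn
    simp [Finset.prod_mul_distrib]
  · obtain ⟨a, ha⟩ := Function.ne_iff.1 hmn
    exact Finset.prod_eq_zero (Finset.mem_univ a) (if_neg ha)

theorem finrank_real_ket (d : ℕ) : Module.finrank ℝ (Ket d) = 2 * d := by
  rw [(WithLp.linearEquiv 2 ℝ (Fin d → ℂ)).finrank_eq, Module.finrank_pi_fintype]
  simp [mul_comm]

/-- The Lebesgue measures of the Euclidean space `ℂ^d` and of the product `ℂ^d` are
proportional. -/
theorem exists_integral_ket_eq (d : ℕ) : ∃ c : ℝ, ∀ f : Ket d → ℂ,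
    ∫ x, f x = c * ∫ z : Fin d → ℂ, f (WithLp.toLp 2 z) := by
  set L := (PiLp.continuousLinearEquiv 2 ℝ (fun _ : Fin d => ℂ)).symm
  have hL : (Measure.map L (volume : Measure (Fin d → ℂ))).IsAddHaarMeasure :=
    L.isAddHaarMeasure_map volume
  obtain ⟨c, hc⟩ : ∃ c : NNReal, (volume : Measure (Ket d)) = c • Measure.map L volume :=
    ⟨_, Measure.isAddLeftInvariant_eq_smul _ _⟩
  refine ⟨c, fun f => ?_⟩
  have hmap : ∫ x, f x ∂(Measure.map L volume) = ∫ z, f (L z) :=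
    L.toHomeomorph.measurableEmbedding.integral_map f
  rw [hc, integral_smul_nnreal_measure, hmap, NNReal.smul_def, Complex.real_smul]
  rfl

/-! ### Moments of Haar-random unit vectors -/

instance isProbabilityMeasure_haarKet {d : ℕ} [NeZero d] : IsProbabilityMeasure (haarKet d) := by
  have : (volume : Measure (Ket d)).toSphere ≠ 0 := Measure.toSphere_ne_zero _
  constructor
  rw [haarKet, Measure.smul_apply, smul_eq_mul]
  exact ENNReal.inv_mul_cancel (by rwa [Ne, Measure.measure_univ_eq_zero]) (measure_ne_top _ _)

/-- Monomial moments of the surface measure, by evaluating a Gaussian integral both in polar and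
in product coordinates. The constant `c` absorbs the normalisation of the volume of `Ket d`. -/
theorem integral_toSphere_monomial {d : ℕ} [NeZero d] : ∃ c : ℂ,
    ∀ (m n : Fin d → ℕ) (T : ℕ), ∑ a, m a + ∑ a, n a = 2 * T →
      (∫ v : Metric.sphere (0 : Ket d) 1, ∏ a, v.1 a ^ m a * star (v.1 a) ^ n a
        ∂(volume : Measure (Ket d)).toSphere) * (d + T - 1).factorial =
      c * if m = n then ∏ a, ((m a).factorial : ℂ) else 0 := by
  obtain ⟨c, hc⟩ := exists_integral_ket_eq d
  refine ⟨2 * c * Real.pi ^ d, fun m n T hT => ?_⟩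
  have h := integral_homogeneous_mul_radial (volume : Measure (Ket d))
    (f := fun x => ∏ a, x a ^ m a * star (x a) ^ n a) (k := 2 * T) ?_
    (fun r => Real.exp (-r ^ 2))
  · rw [finrank_real_ket, integral_Ioi_pow_mul_pow_mul_exp_neg_sq (NeZero.pos d), hc] at h
    simp only [EuclideanSpace.norm_sq_eq] at h
    rw [integral_pi_monomial_mul_gaussian] at h
    push_cast at h
    rw [mul_div_assoc', eq_div_iff two_ne_zero] at h
    rw [← h]
    split_ifs
    · ring
    · ring
  · intro r _ x
    simp only [PiLp.smul_apply, Complex.real_smul, star_mul', mul_pow, Finset.prod_mul_distrib,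
      Finset.prod_pow_eq_pow_sum, Complex.star_def, Complex.conj_ofReal]
    rw [← hT, pow_add]
    ring

/-- The moments of the coordinates of a Haar-random unit vector. The unknown constant `c` of
`integral_toSphere_monomial` cancels against its value for the constant monomial. -/
theorem integral_haarKet_monomial {d : ℕ} [NeZero d] (m n : Fin d → ℕ) (T : ℕ)
    (hT : ∑ a, m a + ∑ a, n a = 2 * T) :
    ∫ v, ∏ a, v.1 a ^ m a * star (v.1 a) ^ n a ∂(haarKet d) =
      (∏ k ∈ Finset.range T, ((d : ℂ) + k))⁻¹ *
        if m = n then ∏ a, ((m a).factorial : ℂ) else 0 := by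
  obtain ⟨c, hc⟩ := integral_toSphere_monomial (d := d)
  set σ := (volume : Measure (Ket d)).toSphere with hσ
  have h0 := hc 0 0 0 (by simp)
  have h := hc m n T hT
  have hσ0 : (σ.real Set.univ : ℂ) ≠ 0 := by
    have : σ ≠ 0 := Measure.toSphere_ne_zero _
    rwa [Ne, Complex.ofReal_eq_zero, measureReal_eq_zero_iff, Measure.measure_univ_eq_zero]
  simp only [Pi.zero_apply, pow_zero, mul_one, Finset.prod_const_one, integral_const,
    Complex.real_smul, add_zero, Nat.factorial_zero, Nat.cast_one, if_true] at h0
  have hfact : ((d + T - 1).factorial : ℂ) =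
      (d - 1).factorial * ∏ k ∈ Finset.range T, ((d : ℂ) + k) := by
    have := Nat.factorial_mul_ascFactorial (d - 1) T
    have hd := NeZero.pos d
    rw [Nat.ascFactorial_eq_prod_range, show d - 1 + 1 = d by omega,
      show d - 1 + T = d + T - 1 by omega] at this
    exact_mod_cast this.symm
  have hfT : ((d + T - 1).factorial : ℂ) ≠ 0 := by exact_mod_cast Nat.factorial_ne_zero _
  rw [hfact] at hfT
  have hP := right_ne_zero_of_mul hfT
  rw [haarKet, integral_smul_measure, ← hσ, ENNReal.toReal_inv, ← Measure.real,
    Complex.real_smul, Complex.ofReal_inv, inv_mul_eq_iff_eq_mul₀ hσ0]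
  rw [hfact, ← h0] at h
  have hf1 := left_ne_zero_of_mul hfT
  generalize (if m = n then ∏ a, ((m a).factorial : ℂ) else 0) = K at h ⊢
  field_simp
  refine mul_left_cancel₀ hf1 ?_
  linear_combination h

/-- The number of positions at which a word takes a given value. -/
def letterCount {d T : ℕ} (i : Fin T → Fin d) (a : Fin d) : ℕ :=
  Fintype.card {t // i t = a}

theorem prod_comp_eq_prod_pow_letterCount {d T : ℕ} (i : Fin T → Fin d) (f : Fin d → ℂ) :
    ∏ t, f (i t) = ∏ a, f a ^ letterCount i a := by
  rw [← Finset.prod_fiberwise Finset.univ i]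
  refine Finset.prod_congr rfl fun a _ => ?_
  rw [Finset.prod_congr rfl (g := fun _ => f a) (by simp +contextual), Finset.prod_const,
    letterCount, Fintype.card_subtype]

theorem sum_letterCount {d T : ℕ} (i : Fin T → Fin d) : ∑ a, letterCount i a = T := by
  simp only [letterCount, Fintype.card_subtype]
  rw [← Finset.card_eq_sum_card_fiberwise (by simp)]
  simp

/-- The permutations carrying one word to another: none unless the words are rearrangements of
each other, and otherwise a coset of the stabiliser, a product of symmetric groups. -/
theorem sum_permOp_apply {d T : ℕ} (i j : Fin T → Fin d) :
    ∑ π : Equiv.Perm (Fin T), permOp d π i j =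
      if letterCount i = letterCount j then ∏ a, ((letterCount i a).factorial : ℂ) else 0 := by
  simp only [permOp, Matrix.of_apply]
  split_ifs with h
  · obtain ⟨σ, hσ⟩ : ∃ σ : Equiv.Perm (Fin T), i ∘ σ = j := by
      have e : ∀ a, Nonempty ({t // j t = a} ≃ {t // i t = a}) := fun a =>
        Fintype.card_eq.1 (congrFun h a).symm
      exact ⟨Equiv.ofFiberEquiv fun a => (e a).some,
        funext fun t => Equiv.ofFiberEquiv_map _ t⟩
    have := DomMulAct.stabilizer_card i
    rw [Fintype.card_subtype] at this
    have h2 : ∏ a, ((letterCount i a).factorial : ℂ) =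
        ∑ g : Equiv.Perm (Fin T), if i = i ∘ g then (1 : ℂ) else 0 := by
      rw [← Finset.sum_filter, Finset.sum_const, nsmul_one]
      simp only [eq_comm (a := i)]
      rw [this]
      push_cast
      rfl
    rw [h2, ← Equiv.sum_comp ((Equiv.inv _).trans (Equiv.mulRight σ))]
    refine Finset.sum_congr rfl fun g _ => ?_
    have : j ∘ ((Equiv.inv _).trans (Equiv.mulRight σ) g).symm = i ∘ g := by
      rw [← hσ]
      ext t
      simp [Equiv.Perm.mul_def, Equiv.Perm.inv_def]
    rw [this]
  · refine Finset.sum_eq_zero fun π _ => if_neg fun hij => h ?_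
    ext a
    refine Fintype.card_congr (π.symm.subtypeEquiv fun t => ?_)
    rw [hij]
    rfl

theorem tensorOp_ketbra_apply {d T : ℕ} (v : Ket d) (i j : Fin T → Fin d) :
    tensorOp (fun _ : Fin T => ketbra v) i j =
      ∏ a, v a ^ letterCount i a * star (v a) ^ letterCount j a := by
  simp only [tensorOp, ketbra, Matrix.of_apply, Finset.prod_mul_distrib]
  rw [prod_comp_eq_prod_pow_letterCount i fun a => v a,
    prod_comp_eq_prod_pow_letterCount j fun a => star (v a)]

theorem integrable_haarKet_of_continuous {d : ℕ} [NeZero d] {E : Type*} [NormedAddCommGroup E]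
    {f : Metric.sphere (0 : Ket d) 1 → E} (hf : Continuous f) : Integrable f (haarKet d) :=
  hf.integrable_of_hasCompactSupport (HasCompactSupport.of_compactSpace f)

theorem continuous_tensorOp_ketbra_apply {d T : ℕ} (i j : Fin T → Fin d) :
    Continuous fun v : Metric.sphere (0 : Ket d) 1 =>
      tensorOp (fun _ : Fin T => ketbra (v : Ket d)) i j := by
  simp only [tensorOp, ketbra, Matrix.of_apply]
  fun_prop

theorem integral_tensorOp_ketbra {d : ℕ} [NeZero d] (T : ℕ) (i j : Fin T → Fin d) :
    ∫ v : Metric.sphere (0 : Ket d) 1, tensorOp (fun _ : Fin T => ketbra (v : Ket d)) i j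
        ∂(haarKet d) =
      (∏ k ∈ Finset.range T, ((d : ℂ) + k))⁻¹ *
        ∑ π : Equiv.Perm (Fin T), permOp d π i j := by
  simp only [tensorOp_ketbra_apply]
  rw [integral_haarKet_monomial _ _ T (by rw [sum_letterCount, sum_letterCount, two_mul]),
    sum_permOp_apply]

/-! ### Product effects on Haar-random pure states -/

theorem re_trace_ketbra {d : ℕ} (v : Ket d) : (ketbra v).trace.re = ‖v‖ ^ 2 := by
  have : (ketbra v).trace = ((‖v‖ ^ 2 : ℝ) : ℂ) := sum_mul_star_eq_norm_sq v
  rw [this, Complex.ofReal_re]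

theorem trace_ketbra_mul_ketbra {d : ℕ} (u v : Ket d) :
    (ketbra u * ketbra v).trace =
      (∑ a, u a * star (v a)) * star (∑ a, u a * star (v a)) := by
  simp only [Matrix.trace, Matrix.diag_apply, Matrix.mul_apply, ketbra, Matrix.of_apply]
  rw [star_sum, Finset.sum_mul_sum]
  refine Finset.sum_congr rfl fun i _ => Finset.sum_congr rfl fun j _ => ?_
  rw [star_mul', star_star]
  ring

theorem ofReal_re_trace_ketbra_mul_ketbra {d : ℕ} (u v : Ket d) :
    (((ketbra u * ketbra v).trace.re : ℝ) : ℂ) = (ketbra u * ketbra v).trace := by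
  have h : (ketbra u * ketbra v).trace =
      ((‖∑ a, u a * star (v a)‖ ^ 2 : ℝ) : ℂ) := by
    rw [trace_ketbra_mul_ketbra]
    push_cast
    exact Complex.mul_conj' _
  rw [h, Complex.ofReal_re]

/-- The left-hand side is `Tr ((⨂ A t) (⨂ B t))`. -/
theorem sum_tensorOp_mul_tensorOp {d T : ℕ} (A B : Fin T → Op d) :
    ∑ i, ∑ j, tensorOp A i j * tensorOp B j i = ∏ t, (A t * B t).trace := by
  simp only [Matrix.trace, Matrix.diag_apply, Matrix.mul_apply, tensorOp, Matrix.of_apply]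
  rw [Fintype.prod_sum]
  refine Finset.sum_congr rfl fun i _ => ?_
  rw [Fintype.prod_sum]
  simp only [Finset.prod_mul_distrib]

theorem continuous_re_trace_mul_ketbra {d : ℕ} (F : Op d) :
    Continuous fun v : Metric.sphere (0 : Ket d) 1 => (F * ketbra (v : Ket d)).trace.re := by
  simp only [Matrix.trace, Matrix.diag_apply, Matrix.mul_apply, ketbra, Matrix.of_apply]
  fun_prop

theorem integral_prod_trace_ketbra_mul_ketbra {d T : ℕ} [NeZero d] (ψ : Fin T → Ket d) :
    ∫ v : Metric.sphere (0 : Ket d) 1, ∏ t, (ketbra (ψ t) * ketbra (v : Ket d)).trace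
        ∂(haarKet d) =
      (∏ k ∈ Finset.range T, ((d : ℂ) + k))⁻¹ * ∑ π : Equiv.Perm (Fin T),
        (permOp d π * tensorOp (fun t => ketbra (ψ t))).trace := by
  have hint : ∀ i j : Fin T → Fin d, Integrable (fun v : Metric.sphere (0 : Ket d) 1 =>
      tensorOp (fun t => ketbra (ψ t)) i j * tensorOp (fun _ : Fin T => ketbra (v : Ket d)) j i)
      (haarKet d) := fun i j =>
    integrable_haarKet_of_continuous
      (continuous_const.mul (continuous_tensorOp_ketbra_apply j i))
  have e : ∀ v : Ket d, ∏ t, (ketbra (ψ t) * ketbra v).trace =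
      ∑ i, ∑ j, tensorOp (fun t => ketbra (ψ t)) i j *
        tensorOp (fun _ : Fin T => ketbra v) j i :=
    fun v => (sum_tensorOp_mul_tensorOp (fun t => ketbra (ψ t)) fun _ => ketbra v).symm
  simp only [e]
  rw [integral_finsetSum _ fun i _ => integrable_finsetSum _ fun j _ => hint i j]
  simp_rw [integral_finsetSum _ fun j _ => hint _ j, integral_const_mul,
    integral_tensorOp_ketbra]
  simp only [Matrix.trace, Matrix.diag_apply, Matrix.mul_apply, Finset.mul_sum]
  conv_rhs =>
    rw [Finset.sum_comm]
    enter [2, j]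
    rw [Finset.sum_comm]
  rw [Finset.sum_comm]
  refine Finset.sum_congr rfl fun i _ => Finset.sum_congr rfl fun j _ =>
    Finset.sum_congr rfl fun π _ => ?_
  ring

theorem prod_norm_sq_le_integral {d T : ℕ} [NeZero d] (ψ : Fin T → Ket d) :
    (∏ k ∈ Finset.range T, ((d : ℝ) + k))⁻¹ * ∏ t, ‖ψ t‖ ^ 2 ≤
      ∫ v : Metric.sphere (0 : Ket d) 1, ∏ t, (ketbra (ψ t) * ketbra (v : Ket d)).trace.re
        ∂(haarKet d) := by
  have h := prod_norm_sq_le_sum_trace ψ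
  have hP : (0 : ℝ) ≤ (∏ k ∈ Finset.range T, ((d : ℝ) + k))⁻¹ := by positivity
  have h2 := mul_le_mul_of_nonneg_left h (Complex.zero_le_real.2 hP)
  have h3 := integral_prod_trace_ketbra_mul_ketbra ψ
  have e : ∀ v : Ket d, ∏ t, (ketbra (ψ t) * ketbra v).trace =
      ((∏ t, (ketbra (ψ t) * ketbra v).trace.re : ℝ) : ℂ) := fun v => by
    rw [Complex.ofReal_prod]
    exact Finset.prod_congr rfl fun t _ => (ofReal_re_trace_ketbra_mul_ketbra _ _).symm
  simp only [e] at h3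
  rw [integral_complex_ofReal] at h3
  refine Complex.real_le_real.1 ?_
  rw [h3]
  push_cast at h2 ⊢
  exact h2

open scoped MatrixOrder in
theorem exists_eq_sum_ketbra {d : ℕ} {F : Op d} (hF : F.PosSemidef) :
    ∃ φ : Fin d → Ket d, F = ∑ a, ketbra (φ a) := by
  obtain ⟨B, rfl⟩ := CStarAlgebra.nonneg_iff_eq_star_mul_self.mp hF.nonneg
  refine ⟨fun a => WithLp.toLp 2 fun i => star (B a i), ?_⟩
  ext i j
  simp [Matrix.sum_apply, ketbra, Matrix.mul_apply, Matrix.star_eq_conjTranspose]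

open scoped MatrixOrder in
theorem re_trace_mul_nonneg {d : ℕ} {F ρ : Op d} (hF : F.PosSemidef) (hρ : ρ.PosSemidef) :
    0 ≤ (F * ρ).trace.re := by
  obtain ⟨B, rfl⟩ := CStarAlgebra.nonneg_iff_eq_star_mul_self.mp hF.nonneg
  rw [Matrix.mul_assoc, Matrix.trace_mul_comm, Matrix.star_eq_conjTranspose]
  exact (Complex.nonneg_iff.1 (hρ.mul_mul_conjTranspose_same B).trace_nonneg).1

theorem posSemidef_ketbra {d : ℕ} (v : Ket d) : (ketbra v).PosSemidef :=
  Matrix.posSemidef_vecMulVec_self_star (v : Fin d → ℂ)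

theorem posSemidef_maximallyMixed (d : ℕ) : (maximallyMixed d).PosSemidef :=
  Matrix.PosSemidef.one.smul (by positivity)

theorem trace_maximallyMixed (d : ℕ) [NeZero d] : (maximallyMixed d).trace.re = 1 := by
  have : (d : ℂ) ≠ 0 := NeZero.ne _
  simp [maximallyMixed, this]

/-- Averaged over a Haar-random pure state, a product effect is, up to the normalisation
`d ^ T / (d (d + 1) ⋯ (d + T - 1))`, at least as likely as in the maximally mixed state. -/
theorem prod_trace_le_integral {d T : ℕ} [NeZero d] (F : Fin T → Op d)
    (hF : ∀ t, (F t).PosSemidef) :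
    (∏ k ∈ Finset.range T, ((d : ℝ) + k))⁻¹ * ∏ t, (F t).trace.re ≤
      ∫ v : Metric.sphere (0 : Ket d) 1, ∏ t, (F t * ketbra (v : Ket d)).trace.re
        ∂(haarKet d) := by
  choose φ hφ using fun t => exists_eq_sum_ketbra (hF t)
  have e1 : ∀ t, (F t).trace.re = ∑ a, ‖φ t a‖ ^ 2 := fun t => by
    rw [hφ t, Matrix.trace_sum, Complex.re_sum]
    simp only [re_trace_ketbra]
  have e2 : ∀ t v, (F t * ketbra v).trace.re = ∑ a, (ketbra (φ t a) * ketbra v).trace.re :=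
    fun t v => by
      conv_lhs => rw [hφ t]
      rw [Finset.sum_mul, Matrix.trace_sum, Complex.re_sum]
  simp only [e1, e2, Fintype.prod_sum]
  rw [integral_finsetSum, Finset.mul_sum]
  · exact Finset.sum_le_sum fun x _ => prod_norm_sq_le_integral fun t => φ t (x t)
  · intro x _
    exact integrable_haarKet_of_continuous
      (continuous_finsetProd _ fun t _ => continuous_re_trace_mul_ketbra _)

/-! ### Learning algorithms without quantum memory -/

theorem POVM.prob_nonneg {d : ℕ} {S : Type} (F : POVM d S) {ρ : Op d} (hρ : ρ.PosSemidef)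
    (s : S) : 0 ≤ F.prob ρ s :=
  re_trace_mul_nonneg (F.posSemidef s) hρ

theorem POVM.hasSum_prob {d : ℕ} {S : Type} (F : POVM d S) (ρ : Op d) :
    HasSum (F.prob ρ) ρ.trace.re := by
  have hc : Continuous fun A : Op d => (A * ρ).trace.re := by fun_prop
  have := F.hasSum_effect.map
    (Complex.reAddGroupHom.comp
      ((Matrix.traceAddMonoidHom (Fin d) ℂ).comp (AddMonoidHom.mulRight ρ))) hc
  rw [show F.prob ρ = fun s => (F.effect s * ρ).trace.re from rfl]
  simpa [Function.comp_def] using this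

theorem POVM.prob_maximallyMixed {d : ℕ} {S : Type} (F : POVM d S) (s : S) :
    F.prob (maximallyMixed d) s = (F.effect s).trace.re / d := by
  have : F.prob (maximallyMixed d) s = (((d : ℝ)⁻¹ : ℝ) * (F.effect s).trace).re := by
    simp [POVM.prob, maximallyMixed]
  rw [this, Complex.re_ofReal_mul]
  ring

theorem Learner.answerProb_mem_Icc {d T : ℕ} (A : Learner d T) {ρ : Op d}
    (hρ : ρ.PosSemidef) (h1 : ρ.trace.re = 1) (b : Bool) :
    A.answerProb ρ b ∈ Set.Icc (0 : ℝ) 1 := by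
  induction A with
  | leaf q =>
    have h0 := q.2.1
    have h1 := q.2.2
    cases b <;> simp [Learner.answerProb, h0, h1]
  | measure S hS F next ih =>
    have hp := F.hasSum_prob ρ
    rw [h1] at hp
    have hle : ∀ s, F.prob ρ s * (next s).answerProb ρ b ≤ F.prob ρ s := fun s =>
      mul_le_of_le_one_right (F.prob_nonneg hρ s) (ih s).2
    have h0 : ∀ s, 0 ≤ F.prob ρ s * (next s).answerProb ρ b := fun s =>
      mul_nonneg (F.prob_nonneg hρ s) (ih s).1
    exact ⟨tsum_nonneg h0,
      hasSum_le hle (Summable.of_nonneg_of_le h0 hle hp.summable).hasSum hp⟩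

theorem Learner.summable_prob_mul_answerProb {d T : ℕ} {S : Type} (F : POVM d S)
    (next : S → Learner d T) {ρ : Op d} (hρ : ρ.PosSemidef) (h1 : ρ.trace.re = 1) (b : Bool) :
    Summable fun s => F.prob ρ s * (next s).answerProb ρ b :=
  Summable.of_nonneg_of_le
    (fun s => mul_nonneg (F.prob_nonneg hρ s) ((next s).answerProb_mem_Icc hρ h1 b).1)
    (fun s => mul_le_of_le_one_right (F.prob_nonneg hρ s)
      ((next s).answerProb_mem_Icc hρ h1 b).2)
    (F.hasSum_prob ρ).summable

theorem Learner.answerProb_true_add_false {d T : ℕ} (A : Learner d T) {ρ : Op d}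
    (hρ : ρ.PosSemidef) (h1 : ρ.trace.re = 1) :
    A.answerProb ρ true + A.answerProb ρ false = 1 := by
  induction A with
  | leaf q => simp [Learner.answerProb]
  | measure S hS F next ih =>
    simp only [Learner.answerProb]
    rw [← (summable_prob_mul_answerProb F next hρ h1 true).tsum_add
      (summable_prob_mul_answerProb F next hρ h1 false)]
    simp only [← mul_add, ih, mul_one]
    rw [(F.hasSum_prob ρ).tsum_eq, h1]

theorem Learner.measurable_answerProb {d T : ℕ} (A : Learner d T) (b : Bool) :
    Measurable fun v : Metric.sphere (0 : Ket d) 1 => A.answerProb (ketbra (v : Ket d)) b := by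
  induction A with
  | leaf q => exact measurable_const
  | measure S hS F next ih =>
    exact Measurable.tsum fun s =>
      (continuous_re_trace_mul_ketbra (F.effect s)).measurable.mul (ih s)

theorem re_trace_ketbra_sphere {d : ℕ} (v : Metric.sphere (0 : Ket d) 1) :
    (ketbra (v : Ket d)).trace.re = 1 := by
  rw [re_trace_ketbra, norm_eq_of_mem_sphere, one_pow]

theorem Learner.integrable_mul_answerProb {d T : ℕ} [NeZero d] (A : Learner d T) (b : Bool)
    {w : Metric.sphere (0 : Ket d) 1 → ℝ} (hw : Continuous w) :
    Integrable (fun v => w v * A.answerProb (ketbra (v : Ket d)) b) (haarKet d) := by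
  refine (integrable_haarKet_of_continuous hw).mul_bdd (c := 1)
    (A.measurable_answerProb b).aestronglyMeasurable (Filter.Eventually.of_forall fun v => ?_)
  have h := A.answerProb_mem_Icc (posSemidef_ketbra v.1) (re_trace_ketbra_sphere v) b
  rw [Real.norm_of_nonneg h.1]
  exact h.2

/-- Comparison of the answer probabilities on a Haar-random pure state and on the maximally mixed
state. The induction over the tree needs the effects `F` observed on the path from the root of the
whole tree to the root of the subtree `A`; at a leaf it ends with `prod_trace_le_integral`. -/
theorem Learner.answerProb_maximallyMixed_le_integral {d T : ℕ} [NeZero d] (A : Learner d T)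
    (b : Bool) {m : ℕ} (F : Fin m → Op d) (hF : ∀ t, (F t).PosSemidef) :
    (∏ k ∈ Finset.range (m + T), ((d : ℝ) + k))⁻¹ * (∏ t, (F t).trace.re) *
        ((d : ℝ) ^ T * A.answerProb (maximallyMixed d) b) ≤
      ∫ v : Metric.sphere (0 : Ket d) 1, (∏ t, (F t * ketbra (v : Ket d)).trace.re) *
        A.answerProb (ketbra (v : Ket d)) b ∂(haarKet d) := by
  have hd : (d : ℝ) ≠ 0 := NeZero.ne _
  induction A generalizing m with
  | leaf q =>
    have hq : 0 ≤ (Learner.leaf q : Learner d 0).answerProb (maximallyMixed d) b :=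
      ((Learner.leaf q).answerProb_mem_Icc (posSemidef_maximallyMixed d)
        (trace_maximallyMixed d) b).1
    have h := mul_le_mul_of_nonneg_right (prod_trace_le_integral F hF) hq
    rw [← integral_mul_const] at h
    simpa [Learner.answerProb] using h
  | @measure T S hS G next ih =>
    have hw : Continuous fun v : Metric.sphere (0 : Ket d) 1 =>
        ∏ t, (F t * ketbra (v : Ket d)).trace.re :=
      continuous_finsetProd _ fun t _ => continuous_re_trace_mul_ketbra _
    have hs := summable_prob_mul_answerProb G next (posSemidef_maximallyMixed d)
      (trace_maximallyMixed d) b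
    rw [Learner.answerProb, ← tsum_mul_left, ← tsum_mul_left]
    -- Finite sums of outcomes suffice, so no sum has to be exchanged with the integral.
    refine ((hs.mul_left _).mul_left _).tsum_le_of_sum_le fun u => ?_
    calc _ ≤ ∑ s ∈ u, ∫ v : Metric.sphere (0 : Ket d) 1,
          (G.prob (ketbra (v : Ket d)) s * ∏ t, (F t * ketbra (v : Ket d)).trace.re) *
            (next s).answerProb (ketbra (v : Ket d)) b ∂(haarKet d) := by
          refine Finset.sum_le_sum fun s _ => ?_
          have h := ih s (m := m + 1) (Fin.cons (G.effect s) F)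
            (Fin.cases (G.posSemidef s) hF)
          simp only [Fin.prod_univ_succ, Fin.cons_zero, Fin.cons_succ] at h
          refine le_trans (le_of_eq ?_) h
          rw [G.prob_maximallyMixed, show m + (T + 1) = m + 1 + T by ring]
          field_simp
          ring
      _ = ∫ v : Metric.sphere (0 : Ket d) 1, ∑ s ∈ u,
          (G.prob (ketbra (v : Ket d)) s * ∏ t, (F t * ketbra (v : Ket d)).trace.re) *
            (next s).answerProb (ketbra (v : Ket d)) b ∂(haarKet d) :=
          (integral_finsetSum _ fun s _ => (next s).integrable_mul_answerProb b
            ((continuous_re_trace_mul_ketbra (G.effect s)).mul hw)).symm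
      _ ≤ _ := by
          refine integral_mono
            (integrable_finsetSum _ fun s _ => (next s).integrable_mul_answerProb b
              ((continuous_re_trace_mul_ketbra (G.effect s)).mul hw))
            ((Learner.measure S hS G next).integrable_mul_answerProb b hw) fun v => ?_
          have hv := posSemidef_ketbra v.1
          have hsum := summable_prob_mul_answerProb G next hv (re_trace_ketbra_sphere v) b
          have hle := hsum.sum_le_tsum u fun s _ => mul_nonneg (G.prob_nonneg hv s)
            ((next s).answerProb_mem_Icc hv (re_trace_ketbra_sphere v) b).1
          have hw0 : 0 ≤ ∏ t, (F t * ketbra (v : Ket d)).trace.re :=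
            Finset.prod_nonneg fun t _ => re_trace_mul_nonneg (hF t) hv
          simp only [Learner.answerProb]
          refine le_trans (le_of_eq ?_) (mul_le_mul_of_nonneg_left hle hw0)
          rw [Finset.mul_sum]
          exact Finset.sum_congr rfl fun s _ => by ring

/-- A birthday-type estimate: `d (d + 1) ⋯ (d + T - 1)` is close to `d ^ T` while `T ^ 2 ≪ d`. -/
theorem prod_add_mul_one_sub_le {d : ℕ} [NeZero d] (T : ℕ) :
    (∏ k ∈ Finset.range T, ((d : ℝ) + k)) * (1 - (T : ℝ) ^ 2 / d) ≤ (d : ℝ) ^ T := by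
  have hd : (0 : ℝ) < d := Nat.cast_pos.2 (NeZero.pos d)
  induction T with
  | zero => simp
  | succ T ih =>
    rw [Finset.prod_range_succ, pow_succ (d : ℝ)]
    refine le_trans ?_ (mul_le_mul_of_nonneg_right ih hd.le)
    rw [mul_assoc, mul_assoc]
    refine mul_le_mul_of_nonneg_left ?_ (by positivity)
    have h : 0 ≤ (T : ℝ) * ((T + 1 : ℝ) ^ 2 / d) := by positivity
    have e1 : (1 - (T : ℝ) ^ 2 / d) * d = d - (T : ℝ) ^ 2 := by field_simp
    have e2 : ((d : ℝ) + T) * (1 - ((T + 1 : ℕ) : ℝ) ^ 2 / d) =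
        d + T - (T + 1 : ℝ) ^ 2 - T * ((T + 1 : ℝ) ^ 2 / d) := by
      push_cast
      field_simp
      ring
    rw [e1, e2]
    nlinarith [(Nat.cast_nonneg T : (0 : ℝ) ≤ T)]

theorem Learner.integral_answerProb_true {d T : ℕ} [NeZero d] (A : Learner d T) :
    ∫ v : Metric.sphere (0 : Ket d) 1, A.answerProb (ketbra (v : Ket d)) true ∂(haarKet d) =
      1 - ∫ v : Metric.sphere (0 : Ket d) 1, A.answerProb (ketbra (v : Ket d)) false
        ∂(haarKet d) := by
  have h := A.integrable_mul_answerProb false continuous_const (w := fun _ => 1)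
  simp only [one_mul] at h
  have e : ∀ v : Metric.sphere (0 : Ket d) 1, A.answerProb (ketbra (v : Ket d)) true =
      1 - A.answerProb (ketbra (v : Ket d)) false := fun v =>
    eq_sub_of_add_eq (A.answerProb_true_add_false (posSemidef_ketbra v.1)
      (re_trace_ketbra_sphere v))
  simp only [e]
  rw [integral_sub (integrable_const _) h]
  simp

theorem Learner.Distinguishes.distinguishesOnAverage {d T : ℕ} [NeZero d] {A : Learner d T}
    (hA : A.Distinguishes) : A.DistinguishesOnAverage := by
  have h : (2 / 3 : ℝ) ≤ ∫ v : Metric.sphere (0 : Ket d) 1,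
      A.answerProb (ketbra (v : Ket d)) true ∂(haarKet d) := by
    have hi := A.integrable_mul_answerProb true continuous_const (w := fun _ => 1)
    simp only [one_mul] at hi
    have := integral_mono (integrable_const (2 / 3 : ℝ)) hi fun v =>
      hA.2 _ ⟨v.1, norm_eq_of_mem_sphere v, rfl⟩
    simpa using this
  have := hA.1
  unfold Learner.DistinguishesOnAverage
  linarith

/-- If `x` is the probability of the answer `false` on the maximally mixed state, then a Haar-random
pure state causes it with probability at least `(1 - T ^ 2 / d) x`, so the advantage of the
algorithm over guessing is at most `T ^ 2 / (2 d)`. -/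
theorem Learner.DistinguishesOnAverage.le_sq {d T : ℕ} [NeZero d] {A : Learner d T}
    (hA : A.DistinguishesOnAverage) : (d : ℝ) ≤ 3 * (T : ℝ) ^ 2 := by
  have hd : (0 : ℝ) < d := Nat.cast_pos.2 (NeZero.pos d)
  have hx := A.answerProb_mem_Icc (posSemidef_maximallyMixed d) (trace_maximallyMixed d) false
  have h := A.answerProb_maximallyMixed_le_integral false (m := 0) Fin.elim0 (Fin.elim0 ·)
  unfold Learner.DistinguishesOnAverage at hA
  rw [A.integral_answerProb_true] at hA
  simp only [Finset.univ_eq_empty, Finset.prod_empty, zero_add, mul_one, one_mul] at h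
  set x := A.answerProb (maximallyMixed d) false
  have hP : (0 : ℝ) < ∏ k ∈ Finset.range T, ((d : ℝ) + k) :=
    Finset.prod_pos fun k _ => by positivity
  have hr : (1 - (T : ℝ) ^ 2 / d) * x ≤
      (∏ k ∈ Finset.range T, ((d : ℝ) + k))⁻¹ * ((d : ℝ) ^ T * x) := by
    rw [← mul_assoc]
    refine mul_le_mul_of_nonneg_right ?_ hx.1
    rw [le_inv_mul_iff₀ hP]
    exact prod_add_mul_one_sub_le T
  have h3 : (T : ℝ) ^ 2 / d * x ≤ (T : ℝ) ^ 2 / d :=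
    mul_le_of_le_one_right (by positivity) hx.2
  have h4 : (1 : ℝ) / 3 ≤ (T : ℝ) ^ 2 / d := by linarith
  rw [div_le_div_iff₀ (by norm_num) hd] at h4
  linarith

end PurityTesting

theorem mainTheorem4 :
    (∃ c : ℝ, 0 < c ∧ ∀ (n T : ℕ) (A : PurityTesting.Learner (2 ^ n) T),
      (A.Distinguishes ∨ A.DistinguishesOnAverage) → c * (2 : ℝ) ^ ((n : ℝ) / 2) ≤ (T : ℝ)) ∧
    (∀ (n T : ℕ) (i j : Fin T → Fin (2 ^ n)),
      MeasureTheory.Integrable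
        (fun v : Metric.sphere (0 : PurityTesting.Ket (2 ^ n)) 1 =>
          PurityTesting.tensorOp (fun _ : Fin T =>
            PurityTesting.ketbra (v : PurityTesting.Ket (2 ^ n))) i j)
        (PurityTesting.haarKet (2 ^ n)) ∧
      ∫ v : Metric.sphere (0 : PurityTesting.Ket (2 ^ n)) 1,
          PurityTesting.tensorOp (fun _ : Fin T =>
            PurityTesting.ketbra (v : PurityTesting.Ket (2 ^ n))) i j
          ∂(PurityTesting.haarKet (2 ^ n)) =
        ((∏ k ∈ Finset.range T, ((2 : ℂ) ^ n + (k : ℂ)))⁻¹ •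
          ∑ π : Equiv.Perm (Fin T), PurityTesting.permOp (2 ^ n) π) i j) ∧
    (∀ (d T : ℕ) (ψ : Fin T → PurityTesting.Ket d), (∀ t, ‖ψ t‖ = 1) →
      (∑ π : Equiv.Perm (Fin T), (PurityTesting.permOp d π *
        PurityTesting.tensorOp (fun t => PurityTesting.ketbra (ψ t))).trace).im = 0 ∧
      1 ≤ (∑ π : Equiv.Perm (Fin T), (PurityTesting.permOp d π *
        PurityTesting.tensorOp (fun t => PurityTesting.ketbra (ψ t))).trace).re) := by
  refine ⟨⟨1 / 2, by norm_num, fun n T A hA => ?_⟩, fun n T i j => ⟨?_, ?_⟩,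
    fun d T ψ hψ => ?_⟩
  · have h := (hA.elim (fun h => h.distinguishesOnAverage) id).le_sq
    have hsq : ((2 : ℝ) ^ ((n : ℝ) / 2)) ^ 2 = 2 ^ n := by
      rw [← Real.rpow_natCast, ← Real.rpow_mul (by norm_num)]
      simp
    push_cast at h
    rw [← hsq] at h
    refine le_of_sq_le_sq ?_ (Nat.cast_nonneg T)
    nlinarith
  · exact PurityTesting.integrable_haarKet_of_continuous
      (PurityTesting.continuous_tensorOp_ketbra_apply i j)
  · rw [PurityTesting.integral_tensorOp_ketbra, Matrix.smul_apply, Matrix.sum_apply]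
    simp
  · have h := PurityTesting.prod_norm_sq_le_sum_trace ψ
    simp only [hψ, one_pow, Finset.prod_const_one, Complex.le_def] at h
    exact ⟨h.2.symm, h.1⟩
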